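/- Let $V$ be a (Hausdorff) real locally convex vector space and let $\omega\colon V\times V\to\mathbb{R}$ be a continuous, non-degenerate, skew-symmetric bilinear form. Let $\mathbb{T}\times_\omega V$ be the Heisenberg group, that is, the set $\mathbb{T}\times V$, where $\mathbb{T}=\{z\in\mathbb{C} : |z|=1\}$, with its product manifold structure and the multiplication $$(z,v)(z',v')=\bigl(zz'e^{\frac{i}{2}\omega(v,v')},\,v+v'\bigr).$$ A map between open subsets of locally convex spaces is smooth if it is continuous and its iterated directional derivatives $(\partial_{h_j}\cdots\partial_{h_1}f)(x)$ of all orders exist and are jointly continuous in $(x,h_1,\dots,h_j)$. A unitary representation of a group $G=\mathbb{T}\times_\omega V$ on a complex Hilbert space $\mathcal{H}$ is a homomorphism $\rho$ from $G$ to the group of unitary operators of $\mathcal{H}$; it is smooth if the vectors $\psi\in\mathcal{H}$ whose orbit map $G\to\mathcal{H}$, $g\mapsto\rho(g)\psi$, is smooth form a dense subset of $\mathcal{H}$. Then $\mathbb{T}\times_\omega V$ possesses a smooth unitary representation $\rho$ on a non-zero complex Hilbert space $\mathcal{H}$ with $\rho(z,0)=z\mathbf{1}$ for all $z\in\mathbb{T}$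 if and only if there exists a continuous Hermitian inner product $H$ (a positive definite Hermitian form, antilinear in the first and linear in the second argument) on the complexification $V_{\mathbb{C}}=V\oplus iV$, with the product topology, such that $$\omega(v,v')=-2\,\mathrm{Im}\,H(v,v')\qquad\text{for all } v,v'\in V.$$ -/

import Mathlib

open scoped Topology ComplexConjugate

universe u w

noncomputable section

/-! ### Smooth maps between locally convex spaces -/

section Smooth

variable {E F : Type*} [AddCommGroup E] [Module ℝ E] [TopologicalSpace E]
  [AddCommGroup F] [Module ℝ F] [TopologicalSpace F]

/-- The directional derivative `∂_h f (x) = lim_{t → 0} t⁻¹ (f (x + t h) - f x)` exists and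
equals `y`. -/
def HasDirDerivAt (f : E → F) (x h : E) (y : F) : Prop :=
  Filter.Tendsto (fun t : ℝ => t⁻¹ • (f (x + t • h) - f x)) (𝓝[≠] 0) (𝓝 y)

/-- Smoothness of `f` on the open set `U`: the iterated directional derivatives
`D j x (h₁, …, h_j) = (∂_{h_j} ⋯ ∂_{h₁} f) (x)` of all orders exist at all points of `U`, and all
the maps `D j : U × E ^ j → F` (including `D 0 = f`) are continuous. -/
def LCSmoothOn (f : E → F) (U : Set E) : Prop :=
  ∃ D : (j : ℕ) → E → (Fin j → E) → F,
    (∀ x ∈ U, ∀ h : Fin 0 → E, D 0 x h = f x) ∧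
    (∀ (j : ℕ), ∀ x ∈ U, ∀ (h : Fin j → E) (e : E),
      HasDirDerivAt (fun y => D j y h) x e
        (D (j + 1) x (Fin.snoc (α := fun _ => E) h e))) ∧
    (∀ j : ℕ, ContinuousOn (fun p : E × (Fin j → E) => D j p.1 p.2) (U ×ˢ Set.univ))

end Smooth

/-! ### The group `𝕋 ×_ω V` -/

/-- The set `𝕋 × V` underlying the group `𝕋 ×_ω V`. -/
@[ext]
structure HeisenbergGroup {V : Type*} [AddCommGroup V] [Module ℝ V]
    (ω : LinearMap.BilinForm ℝ V) where
  phase : Circle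
  vec : V

namespace HeisenbergGroup

variable {V : Type*} [AddCommGroup V] [Module ℝ V] {ω : LinearMap.BilinForm ℝ V}

/-- `(z, v) (z', v') = (z z' exp (i ω(v, v') / 2), v + v')`. -/
instance : Mul (HeisenbergGroup ω) :=
  ⟨fun g g' => ⟨g.phase * g'.phase * Circle.exp (ω g.vec g'.vec / 2), g.vec + g'.vec⟩⟩

instance : One (HeisenbergGroup ω) := ⟨⟨1, 0⟩⟩

/-- For skew-symmetric `ω` this is `(z⁻¹, -v)`. -/
instance : Inv (HeisenbergGroup ω) :=
  ⟨fun g => ⟨g.phase⁻¹ * Circle.exp (ω g.vec g.vec / 2), -g.vec⟩⟩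

@[simp] lemma mul_phase (g g' : HeisenbergGroup ω) :
    (g * g').phase = g.phase * g'.phase * Circle.exp (ω g.vec g'.vec / 2) := rfl
@[simp] lemma mul_vec (g g' : HeisenbergGroup ω) : (g * g').vec = g.vec + g'.vec := rfl
@[simp] lemma one_phase : (1 : HeisenbergGroup ω).phase = 1 := rfl
@[simp] lemma one_vec : (1 : HeisenbergGroup ω).vec = 0 := rfl
@[simp] lemma inv_phase (g : HeisenbergGroup ω) :
    g⁻¹.phase = g.phase⁻¹ * Circle.exp (ω g.vec g.vec / 2) := rfl
@[simp] lemma inv_vec (g : HeisenbergGroup ω) : g⁻¹.vec = -g.vec := rfl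

instance : Group (HeisenbergGroup ω) :=
  Group.ofLeftAxioms
    (by
      intro a b c
      ext1
      · simp only [mul_phase, mul_vec, map_add, LinearMap.add_apply, add_div, Circle.exp_add]
        simp only [mul_assoc, mul_left_comm, mul_comm]
      · simp [add_assoc])
    (by intro a; ext1 <;> simp)
    (by
      intro a
      ext1
      · simp only [mul_phase, inv_phase, inv_vec, map_neg, LinearMap.neg_apply, neg_div,
          Circle.exp_neg, one_phase]
        rw [mul_right_comm _ _ a.phase]
        simp
      · simp)

end HeisenbergGroup

/-! ### Smooth unitary representations of `𝕋 ×_ω V` -/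

section Rep

variable {V : Type*} [AddCommGroup V] [Module ℝ V] [TopologicalSpace V]
  {ω : LinearMap.BilinForm ℝ V}

/-- Smoothness of a map on the manifold `𝕋 × V`, which is modelled on `ℝ × V`, in the charts
inverse to `(t, v) ↦ (exp (i t), v)`, `t ∈ (θ - π, θ + π)`, `v ∈ V`, for `θ ∈ ℝ`. -/
def HeisenbergGroup.IsSmooth {F : Type*} [AddCommGroup F] [Module ℝ F] [TopologicalSpace F]
    (f : HeisenbergGroup ω → F) : Prop :=
  ∀ θ : ℝ, LCSmoothOn (fun p : ℝ × V => f ⟨Circle.exp p.1, p.2⟩)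
    (Set.Ioo (θ - Real.pi) (θ + Real.pi) ×ˢ Set.univ)

variable {ℋ : Type*} [NormedAddCommGroup ℋ] [InnerProductSpace ℂ ℋ]

/-- The vector `ψ` is smooth: its orbit map `g ↦ ρ(g) ψ` is smooth. -/
def IsSmoothVector (ρ : HeisenbergGroup ω →* (ℋ ≃ₗᵢ[ℂ] ℋ)) (ψ : ℋ) : Prop :=
  HeisenbergGroup.IsSmooth (fun g : HeisenbergGroup ω => ρ g ψ)

/-- A unitary representation is smooth if its smooth vectors are dense. -/
def IsSmoothUnitaryRep (ρ : HeisenbergGroup ω →* (ℋ ≃ₗᵢ[ℂ] ℋ)) : Prop :=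
  Dense {ψ : ℋ | IsSmoothVector ρ ψ}

end Rep

/-! ### The complexification `V_ℂ` and its Hermitian inner products -/

/-- The complexification `V_ℂ = V ⊕ i V`, the pair `(x, y)` standing for `x + i y`; it carries
the product topology. -/
def Complexified (V : Type*) : Type _ := V × V

namespace Complexified

variable {V : Type*} [AddCommGroup V] [Module ℝ V]

instance : AddCommGroup (Complexified V) := inferInstanceAs (AddCommGroup (V × V))

instance [TopologicalSpace V] : TopologicalSpace (Complexified V) :=
  inferInstanceAs (TopologicalSpace (V × V))

/-- `(a + i b) (x + i y) = (a x - b y) + i (a y + b x)`. -/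
instance : Module ℂ (Complexified V) where
  smul c p := (c.re • p.1 - c.im • p.2, c.re • p.2 + c.im • p.1)
  one_smul p := Prod.ext
    (show (1 : ℂ).re • p.1 - (1 : ℂ).im • p.2 = p.1 by simp)
    (show (1 : ℂ).re • p.2 + (1 : ℂ).im • p.1 = p.2 by simp)
  mul_smul c d p := Prod.ext
    (show (c * d).re • p.1 - (c * d).im • p.2 =
        c.re • (d.re • p.1 - d.im • p.2) - c.im • (d.re • p.2 + d.im • p.1) by
      simp only [Complex.mul_re, Complex.mul_im]; module)
    (show (c * d).re • p.2 + (c * d).im • p.1 =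
        c.re • (d.re • p.2 + d.im • p.1) + c.im • (d.re • p.1 - d.im • p.2) by
      simp only [Complex.mul_re, Complex.mul_im]; module)
  smul_zero c := Prod.ext
    (show c.re • (0 : V) - c.im • (0 : V) = 0 by simp)
    (show c.re • (0 : V) + c.im • (0 : V) = 0 by simp)
  smul_add c p q := Prod.ext
    (show c.re • (p.1 + q.1) - c.im • (p.2 + q.2) =
        (c.re • p.1 - c.im • p.2) + (c.re • q.1 - c.im • q.2) by module)
    (show c.re • (p.2 + q.2) + c.im • (p.1 + q.1) =
        (c.re • p.2 + c.im • p.1) + (c.re • q.2 + c.im • q.1) by module)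
  add_smul c d p := Prod.ext
    (show (c + d).re • p.1 - (c + d).im • p.2 =
        (c.re • p.1 - c.im • p.2) + (d.re • p.1 - d.im • p.2) by
      simp only [Complex.add_re, Complex.add_im]; module)
    (show (c + d).re • p.2 + (c + d).im • p.1 =
        (c.re • p.2 + c.im • p.1) + (d.re • p.2 + d.im • p.1) by
      simp only [Complex.add_re, Complex.add_im]; module)
  zero_smul p := Prod.ext
    (show (0 : ℂ).re • p.1 - (0 : ℂ).im • p.2 = 0 by simp)
    (show (0 : ℂ).re • p.2 + (0 : ℂ).im • p.1 = 0 by simp)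

/-- The inclusion `V ⊆ V_ℂ`. -/
def ofReal (v : V) : Complexified V := ((v, 0) : V × V)

end Complexified

/-- `H` (antilinear in the first, linear in the second argument) is a continuous Hermitian
inner product on `V_ℂ`. -/
structure IsHermitianInnerProduct {V : Type*} [AddCommGroup V] [Module ℝ V] [TopologicalSpace V]
    (H : Complexified V →ₗ⋆[ℂ] Complexified V →ₗ[ℂ] ℂ) : Prop where
  hermitian : ∀ ξ η, H η ξ = conj (H ξ η)
  posDef : ∀ ξ, ξ ≠ 0 → 0 < (H ξ ξ).re
  continuous : Continuous fun p : Complexified V × Complexified V => H p.1 p.2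

end

/-! Put W(v) = ρ(1, v), so that W(v) W(w) = exp(i ω(v, w) / 2) W(v + w).

From a representation to a form: take a smooth vector ψ ≠ 0 and let A v be the derivative of W(t v)
ψ at t = 0. Differentiating the Weyl relations gives ⟨A v, A w⟩ - ⟨A w, A v⟩ = -i ω(v, w) ‖ψ‖²
(`derived_comm`). Hence ⟨A v, A w⟩ / ‖ψ‖² has imaginary part -ω(v, w) / 2 on V. The map A is
continuous and real linear, and non-degeneracy of ω makes it injective. The sesquilinear extension
of this form to V_ℂ may still degenerate, because A V and i A V can meet;
`exists_hermitianInnerProduct` adds a form that is real on V to make it definite.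

From a form to a representation: embed (V_ℂ, H) isometrically into a Hilbert space E. Its Fock space
is generated by the coherent vectors κ(x) = ∑ x^{⊗n} / √n!, with ⟨κ(x), κ(y)⟩ = exp⟨x, y⟩. The rule
κ(x) ↦ z exp(-‖u‖² / 2 - ⟨u, x⟩) κ(x + u) preserves these inner products, so it extends to a unitary
operator (`exists_weyl`). With u running through the image of V these operators multiply like the
Heisenberg group, and finite combinations of coherent vectors are smooth because κ is holomorphic.
-/

noncomputable section

/-! ### The full Fock space and its creation operators -/

namespace FullFock

variable {ι : Type*}

/-- The coordinates of `x ⊗ f` in the full Fock space `ℓ²(List ι)` over `ℓ²(ι)`. -/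
def consFun (x : ι → ℂ) (f : List ι → ℂ) : List ι → ℂ
  | [] => 0
  | i :: t => x i * f t

/-- Non-empty lists correspond to pairs (head, tail); this is the splitting of the full Fock space
into the vacuum line and ℓ²(ι) ⊗ ℓ²(List ι). -/
lemma hasSum_list_of_prod {α : Type*} [AddCommMonoid α] [TopologicalSpace α]
    {G : List ι → α} {s : α} (h0 : G [] = 0)
    (h : HasSum (fun p : ι × List ι => G (p.1 :: p.2)) s) : HasSum G s := by
  have hinj : Function.Injective (fun p : ι × List ι => p.1 :: p.2) := by
    rintro ⟨i, t⟩ ⟨j, u⟩ h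
    simpa using h
  refine (hinj.hasSum_iff ?_).1 h
  rintro (_ | ⟨i, t⟩) hx
  · exact h0
  · exact absurd ⟨(i, t), rfl⟩ hx

lemma memℓp_consFun (x : lp (fun _ : ι => ℂ) 2) (f : lp (fun _ : List ι => ℂ) 2) :
    Memℓp (E := fun _ : List ι => ℂ) (consFun x f) 2 := by
  have hx := (memℓp_gen_iff (by norm_num)).1 (lp.memℓp x)
  have hf := (memℓp_gen_iff (by norm_num)).1 (lp.memℓp f)
  refine (memℓp_gen_iff (by norm_num)).2 ?_
  have h := hx.mul_of_nonneg hf (fun _ => by positivity) (fun _ => by positivity)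
  refine (hasSum_list_of_prod (G := fun l => ‖consFun x f l‖ ^ (2 : ENNReal).toReal)
    (by simp [consFun]) (s := ∑' p : ι × List ι, ‖x p.1‖ ^ (2 : ENNReal).toReal *
      ‖f p.2‖ ^ (2 : ENNReal).toReal) ?_).summable
  convert h.hasSum using 2 with p
  simp [consFun, mul_pow]

/-- The vector `x ⊗ f`. -/
def cons (x : lp (fun _ : ι => ℂ) 2) (f : lp (fun _ : List ι => ℂ) 2) :
    lp (fun _ : List ι => ℂ) 2 :=
  ⟨consFun x f, memℓp_consFun x f⟩

lemma cons_apply (x : lp (fun _ : ι => ℂ) 2) (f : lp (fun _ : List ι => ℂ) 2) (l : List ι) :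
    cons x f l = consFun x f l := rfl

lemma hasSum_mul_prod {κ : Type*} {a : ι → ℂ} {b : κ → ℂ} {s t : ℂ} (ha : HasSum a s)
    (hb : HasSum b t) : HasSum (fun p : ι × κ => a p.1 * b p.2) (s * t) :=
  HasSum.mul ha hb (summable_mul_of_summable_norm ha.summable.norm hb.summable.norm)

lemma inner_cons_cons (x y : lp (fun _ : ι => ℂ) 2) (f g : lp (fun _ : List ι => ℂ) 2) :
    inner ℂ (cons x f) (cons y g) = inner ℂ x y * inner ℂ f g := by
  have h := hasSum_mul_prod (lp.hasSum_inner (𝕜 := ℂ) x y) (lp.hasSum_inner (𝕜 := ℂ) f g)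
  have h2 : HasSum (fun l : List ι => (inner ℂ (cons x f l) (cons y g l) : ℂ))
      (inner ℂ x y * inner ℂ f g) := by
    refine hasSum_list_of_prod (by simp [cons_apply, consFun]) (h.congr_fun fun p => ?_)
    simp only [cons_apply, consFun, RCLike.inner_apply, map_mul]
    ring
  rw [lp.inner_eq_tsum]
  exact h2.tsum_eq

lemma norm_cons (x : lp (fun _ : ι => ℂ) 2) (f : lp (fun _ : List ι => ℂ) 2) :
    ‖cons x f‖ = ‖x‖ * ‖f‖ := by
  have h := inner_cons_cons x x f f
  simp only [inner_self_eq_norm_sq_to_K] at h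
  rw [← sq_eq_sq₀ (by positivity) (by positivity), mul_pow]
  exact_mod_cast h

/-- The creation operators, `creation x f = x ⊗ f`. -/
def creation : lp (fun _ : ι => ℂ) 2 →L[ℂ]
    lp (fun _ : List ι => ℂ) 2 →L[ℂ] lp (fun _ : List ι => ℂ) 2 :=
  LinearMap.mkContinuous₂
    (LinearMap.mk₂ ℂ cons
      (fun x y f => by ext (_ | ⟨i, t⟩) <;> simp [cons_apply, consFun, add_mul])
      (fun c x f => by ext (_ | ⟨i, t⟩) <;> simp [cons_apply, consFun, mul_assoc])
      (fun x f g => by ext (_ | ⟨i, t⟩) <;> simp [cons_apply, consFun, mul_add])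
      (fun c x f => by ext (_ | ⟨i, t⟩) <;> simp [cons_apply, consFun, mul_left_comm])) 1
    (fun x f => by simp [norm_cons])

open scoped Classical in
/-- The vacuum vector. -/
def vacuum (ι : Type*) : lp (fun _ : List ι => ℂ) 2 := lp.single 2 [] 1

lemma inner_vacuum_vacuum : inner ℂ (vacuum ι) (vacuum ι) = 1 := by
  classical
  simp [vacuum]

lemma inner_vacuum_cons (x : lp (fun _ : ι => ℂ) 2) (f : lp (fun _ : List ι => ℂ) 2) :
    inner ℂ (vacuum ι) (cons x f) = 0 := by
  classical
  simp [vacuum, lp.inner_single_left, cons, consFun]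

end FullFock

/-! ### Coherent vectors -/

namespace Coherent

variable {E F : Type*} [NormedAddCommGroup E] [InnerProductSpace ℂ E]
  [NormedAddCommGroup F] [InnerProductSpace ℂ F]

/-- The Taylor coefficients `1 / √n!`. -/
def coeff (n : ℕ) : ℂ := ((√(n.factorial : ℝ))⁻¹ : ℝ)

lemma conj_coeff (n : ℕ) : conj (coeff n) = coeff n := Complex.conj_ofReal _

lemma coeff_mul_self (n : ℕ) : coeff n * coeff n = (n.factorial : ℂ)⁻¹ := by
  rw [coeff, ← Complex.ofReal_mul, ← mul_inv, Real.mul_self_sqrt (by positivity)]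
  simp

/-- The entire function `a ↦ ∑ n, a ^ n / √n!` on a Banach algebra. -/
def expSqrt {A : Type*} [NormedRing A] [NormedAlgebra ℂ A] (a : A) : A :=
  FormalMultilinearSeries.ofScalarsSum coeff a

section expSqrt

variable {A : Type*} [NormedRing A] [NormedAlgebra ℂ A]

lemma radius_coeff : (FormalMultilinearSeries.ofScalars A coeff).radius = ⊤ := by
  refine FormalMultilinearSeries.ofScalars_radius_eq_top_of_tendsto _ _ ?_ ?_
  · refine Filter.Eventually.of_forall fun n => ?_
    have : (0 : ℝ) < √(n.factorial : ℝ) := by positivity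
    simp [coeff, this.ne']
  · have : (fun n : ℕ => ‖coeff n.succ‖ / ‖coeff n‖) = fun n : ℕ => (√((n : ℝ) + 1))⁻¹ := by
      ext n
      have h : (0 : ℝ) < √(n.factorial : ℝ) := by positivity
      simp only [coeff, Nat.succ_eq_add_one, Nat.factorial_succ, Nat.cast_mul,
        Complex.norm_real, Nat.cast_add, Nat.cast_one, norm_inv, Real.norm_eq_abs,
        abs_of_nonneg (Real.sqrt_nonneg _)]
      rw [Real.sqrt_mul (by positivity)]
      field_simp
    rw [this]
    refine Filter.Tendsto.inv_tendsto_atTop (Real.tendsto_sqrt_atTop.comp ?_)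
    exact Filter.tendsto_atTop_add_const_right _ _ tendsto_natCast_atTop_atTop

variable [CompleteSpace A]

lemma hasFPowerSeriesOnBall_expSqrt : HasFPowerSeriesOnBall (expSqrt (A := A))
    (FormalMultilinearSeries.ofScalars A coeff) 0 ⊤ := by
  have := (FormalMultilinearSeries.ofScalars A coeff).hasFPowerSeriesOnBall (by simp [radius_coeff])
  rwa [radius_coeff] at this

lemma hasSum_expSqrt (a : A) : HasSum (fun n => coeff n • a ^ n) (expSqrt a) := by
  have := hasFPowerSeriesOnBall_expSqrt.hasSum (y := a) (by simp)
  simpa [FormalMultilinearSeries.ofScalars_apply_eq] using this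

lemma contDiff_expSqrt : ContDiff ℂ ⊤ (expSqrt (A := A)) :=
  contDiff_iff_contDiffAt.2 fun a =>
    (hasFPowerSeriesOnBall_expSqrt.analyticAt_of_mem (y := a) (by simp)).contDiffAt

end expSqrt

/-- The coherent vector `∑ n, C(x) ^ n Ω / √n!`, for creation operators `C` and a vacuum `Ω`. -/
def coherent (C : E →L[ℂ] F →L[ℂ] F) (Ω : F) (x : E) : F := expSqrt (C x) Ω

/-- Creation operators are stripped off in pairs, each pair giving a factor ⟨x, y⟩; if one side runs
out first, the vacuum is orthogonal to what is left. -/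
lemma inner_pow_vacuum
    {C : E →L[ℂ] F →L[ℂ] F} {Ω : F}
    (hC : ∀ x y f g, inner ℂ (C x f) (C y g) = inner ℂ x y * inner ℂ f g)
    (hΩ : inner ℂ Ω Ω = 1) (hΩC : ∀ x f, inner ℂ Ω (C x f) = 0) (x y : E) (m n : ℕ) :
    inner ℂ ((C x ^ m) Ω) ((C y ^ n) Ω) = if m = n then inner ℂ x y ^ n else 0 := by
  induction m generalizing n with
  | zero =>
    cases n with
    | zero => rwa [if_pos rfl, pow_zero, pow_zero, pow_zero, one_apply_eq_self]
    | succ n => rw [pow_succ', pow_zero, mul_apply_eq_comp, one_apply_eq_self, hΩC]; simp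
  | succ m ih =>
    cases n with
    | zero =>
      rw [← inner_conj_symm, pow_succ', pow_zero, mul_apply_eq_comp, one_apply_eq_self, hΩC]
      simp
    | succ n =>
      rw [pow_succ', pow_succ' (C y), mul_apply_eq_comp, mul_apply_eq_comp, hC, ih]
      simp only [Nat.add_right_cancel_iff, pow_succ']
      split_ifs <;> simp

variable [CompleteSpace F] (C : E →L[ℂ] F →L[ℂ] F) (Ω : F)

lemma contDiff_coherent : ContDiff ℂ ⊤ (coherent C Ω) :=
  (contDiff_expSqrt.comp C.contDiff).clm_apply contDiff_const

lemma hasSum_coherent (x : E) :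
    HasSum (fun n => coeff n • (C x ^ n) Ω) (coherent C Ω x) := by
  have h := (hasSum_expSqrt (C x)).mapL (ContinuousLinearMap.apply ℂ F Ω)
  simp only [ContinuousLinearMap.apply_apply, smul_apply] at h
  exact h

variable {C Ω}

lemma inner_coherent_pow
    (hC : ∀ x y f g, inner ℂ (C x f) (C y g) = inner ℂ x y * inner ℂ f g)
    (hΩ : inner ℂ Ω Ω = 1) (hΩC : ∀ x f, inner ℂ Ω (C x f) = 0) (x y : E) (n : ℕ) :
    inner ℂ (coherent C Ω x) ((C y ^ n) Ω) = coeff n * inner ℂ x y ^ n := by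
  have h := (innerSL ℂ ((C y ^ n) Ω)).hasSum (hasSum_coherent C Ω x)
  have h' : HasSum (fun m => if m = n then coeff n * inner ℂ y x ^ n else 0)
      (inner ℂ ((C y ^ n) Ω) (coherent C Ω x)) := by
    refine h.congr_fun fun m => ?_
    rw [innerSL_apply_apply, inner_smul_right, inner_pow_vacuum hC hΩ hΩC]
    by_cases hmn : m = n
    · subst hmn; simp
    · simp [hmn, Ne.symm hmn]
  rw [← inner_conj_symm, h'.unique (hasSum_ite_eq n _), map_mul, map_pow, conj_coeff,
    inner_conj_symm]

/-- The reproducing kernel of the Fock space. -/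
lemma inner_coherent
    (hC : ∀ x y f g, inner ℂ (C x f) (C y g) = inner ℂ x y * inner ℂ f g)
    (hΩ : inner ℂ Ω Ω = 1) (hΩC : ∀ x f, inner ℂ Ω (C x f) = 0) (x y : E) :
    inner ℂ (coherent C Ω x) (coherent C Ω y) = Complex.exp (inner ℂ x y) := by
  have h := (innerSL ℂ (coherent C Ω x)).hasSum (hasSum_coherent C Ω y)
  have h' := NormedSpace.expSeries_div_hasSum_exp (inner ℂ x y)
  rw [← Complex.exp_eq_exp_ℂ] at h'
  refine HasSum.unique h (h'.congr_fun fun n => ?_)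
  rw [innerSL_apply_apply, inner_smul_right, inner_coherent_pow hC hΩ hΩC, ← mul_assoc,
    coeff_mul_self]
  ring

end Coherent

/-- The exponential of the inner product is the Gram kernel of a holomorphic map into a Hilbert
space, with total range. -/
lemma exists_total_coherent (ι : Type u) : ∃ (ℋ : Type u) (_ : NormedAddCommGroup ℋ)
    (_ : InnerProductSpace ℂ ℋ) (_ : CompleteSpace ℋ) (κ : lp (fun _ : ι => ℂ) 2 → ℋ),
    ContDiff ℂ ⊤ κ ∧ (∀ x y, inner ℂ (κ x) (κ y) = Complex.exp (inner ℂ x y)) ∧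
      Dense (Submodule.span ℂ (Set.range κ) : Set ℋ) := by
  set κ₀ := Coherent.coherent FullFock.creation (FullFock.vacuum ι)
  set K := (Submodule.span ℂ (Set.range κ₀)).topologicalClosure
  have hmem : ∀ x, κ₀ x ∈ K := fun x =>
    Submodule.le_topologicalClosure _ (Submodule.subset_span ⟨x, rfl⟩)
  have hcl : IsClosed (K : Set (lp (fun _ : List ι => ℂ) 2)) :=
    Submodule.isClosed_topologicalClosure _
  have : CompleteSpace K := hcl.completeSpace_coe
  have hproj : ∀ x, ((K.orthogonalProjectionOnto (κ₀ x) : K) : lp (fun _ : List ι => ℂ) 2) = κ₀ x :=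
    fun x => Submodule.starProjection_eq_self_iff.2 (hmem x)
  -- `K` is the closed span of the coherent vectors. Corestricting to it by the orthogonal
  -- projection, which fixes these vectors, keeps κ a composite of smooth maps.
  refine ⟨K, inferInstance, inferInstance, inferInstance,
    fun x => K.orthogonalProjectionOnto (κ₀ x), ?_, fun x y => ?_, ?_⟩
  · exact K.orthogonalProjectionOnto.contDiff.comp (Coherent.contDiff_coherent _ _)
  · rw [Submodule.coe_inner, hproj, hproj]
    exact Coherent.inner_coherent FullFock.inner_cons_cons FullFock.inner_vacuum_vacuum
      FullFock.inner_vacuum_cons x y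
  · rw [dense_iff_closure_eq, Set.eq_univ_iff_forall]
    intro ψ
    rw [Topology.IsInducing.subtypeVal.closure_eq_preimage_closure_image, Set.mem_preimage]
    have him : (Subtype.val '' (Submodule.span ℂ
        (Set.range fun x => K.orthogonalProjectionOnto (κ₀ x)) : Set K)) =
        (Submodule.span ℂ (Set.range κ₀) : Set _) := by
      have := Submodule.map_span K.subtype (Set.range fun x => K.orthogonalProjectionOnto (κ₀ x))
      rw [← Set.range_comp] at this
      have h2 : (K.subtype ∘ fun x => K.orthogonalProjectionOnto (κ₀ x)) = κ₀ := funext hproj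
      rw [h2] at this
      rw [← this]
      rfl
    have hψ : (ψ : lp (fun _ : List ι => ℂ) 2) ∈
        closure (Submodule.span ℂ (Set.range κ₀) : Set (lp (fun _ : List ι => ℂ) 2)) := ψ.2
    rwa [← him] at hψ

/-! ### Isometries between families with the same Gram kernel -/

lemma inner_linearCombination {X ℋ : Type*} [NormedAddCommGroup ℋ] [InnerProductSpace ℂ ℋ]
    (a : X → ℋ) (c d : X →₀ ℂ) :
    inner ℂ (Finsupp.linearCombination ℂ a c) (Finsupp.linearCombination ℂ a d) =
      d.sum fun y t => c.sum fun x s => t * (conj s * inner ℂ (a x) (a y)) := by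
  simp [Finsupp.linearCombination_apply, Finsupp.sum_inner, Finsupp.inner_sum, inner_smul_left,
    inner_smul_right, Finsupp.mul_sum]

/-- The norm of a finite linear combination depends only on the Gram kernel, so matching
coefficients is isometric between dense subspaces and extends by completeness. -/
lemma exists_isometryEquiv_of_gram_eq {X ℋ : Type*} [NormedAddCommGroup ℋ]
    [InnerProductSpace ℂ ℋ] [CompleteSpace ℋ] (a b : X → ℋ)
    (ha : Dense (Submodule.span ℂ (Set.range a) : Set ℋ))
    (hb : Dense (Submodule.span ℂ (Set.range b) : Set ℋ))
    (hab : ∀ x y, inner ℂ (a x) (a y) = inner ℂ (b x) (b y)) :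
    ∃ U : ℋ ≃ₗᵢ[ℂ] ℋ, ∀ x, U (a x) = b x := by
  have hd : ∀ c : X → ℋ, Dense (Submodule.span ℂ (Set.range c) : Set ℋ) →
      DenseRange (Finsupp.linearCombination ℂ c) := fun c hc => by
    rwa [← Finsupp.range_linearCombination] at hc
  have hn : ∀ f : X →₀ ℂ, ‖Finsupp.linearCombination ℂ b (LinearEquiv.refl ℂ _ f)‖ =
      ‖Finsupp.linearCombination ℂ a f‖ := fun f => by
    have : inner ℂ (Finsupp.linearCombination ℂ b f) (Finsupp.linearCombination ℂ b f) =
        inner ℂ (Finsupp.linearCombination ℂ a f) (Finsupp.linearCombination ℂ a f) := by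
      simp only [inner_linearCombination, hab]
    rw [LinearEquiv.refl_apply, @norm_eq_sqrt_re_inner ℂ, this, ← norm_eq_sqrt_re_inner]
  refine ⟨(LinearEquiv.refl ℂ (X →₀ ℂ)).extendOfIsometry _ _ (hd a ha) (hd b hb) hn, fun x => ?_⟩
  have := (LinearEquiv.refl ℂ (X →₀ ℂ)).extendOfIsometry_eq _ _ (hd a ha) (hd b hb) hn
    (Finsupp.single x 1)
  simpa using this

lemma isometryEquiv_ext_of_dense_span {X ℋ : Type*} [NormedAddCommGroup ℋ]
    [InnerProductSpace ℂ ℋ] (a : X → ℋ)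
    (ha : Dense (Submodule.span ℂ (Set.range a) : Set ℋ)) {U W : ℋ ≃ₗᵢ[ℂ] ℋ}
    (h : ∀ x, U (a x) = W (a x)) : U = W := by
  have : Set.EqOn U W (Submodule.span ℂ (Set.range a) : Set ℋ) :=
    LinearMap.eqOn_span (f := (U : ℋ →ₗ[ℂ] ℋ)) (g := (W : ℋ →ₗ[ℂ] ℋ))
      (by rintro _ ⟨x, rfl⟩; exact h x)
  exact LinearIsometryEquiv.ext fun ψ =>
    congrFun (Continuous.ext_on ha U.continuous W.continuous this) ψ

/-! ### Embedding a Hermitian form into a Hilbert space -/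

lemma exists_isometric_embedding {W : Type u} [AddCommGroup W] [Module ℂ W]
    (H : W →ₗ⋆[ℂ] W →ₗ[ℂ] ℂ) (hH : ∀ ξ η, H η ξ = conj (H ξ η))
    (hpos : ∀ ξ, ξ ≠ 0 → 0 < (H ξ ξ).re) :
    ∃ (ι : Type (max u w)) (j : W →ₗ[ℂ] lp (fun _ : ι => ℂ) 2),
      ∀ ξ η, inner ℂ (j ξ) (j η) = H ξ η := by
  let core : InnerProductSpace.Core ℂ W :=
    { inner := fun ξ η => H ξ η
      conj_inner_symm := fun ξ η => (hH η ξ).symm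
      re_inner_nonneg := fun ξ => by
        rcases eq_or_ne ξ 0 with rfl | h
        · simp
        · exact (hpos ξ h).le
      add_left := fun ξ η ζ => by simp
      smul_left := fun ξ η c => by simp
      definite := fun ξ h => by
        by_contra hne
        have := hpos ξ hne
        rw [h] at this
        simp at this }
  let : NormedAddCommGroup W := core.toNormedAddCommGroup
  let : InnerProductSpace ℂ W := InnerProductSpace.ofCore core.toCore
  obtain ⟨s, b, -⟩ := exists_hilbertBasis ℂ (UniformSpace.Completion W)
  -- Reindexing by `ULift` only moves the index type to the universe prescribed for the
  -- representation space.
  have hon : Orthonormal ℂ (fun i : ULift.{w} s => b i.down) :=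
    b.orthonormal.comp _ ULift.down_injective
  have hr : Set.range (fun i : ULift.{w} s => b i.down) = Set.range b :=
    ULift.down_surjective.range_comp b
  let b' : HilbertBasis (ULift.{w} s) ℂ (UniformSpace.Completion W) :=
    HilbertBasis.mk hon (by rw [hr, b.dense_span])
  refine ⟨ULift.{w} s, b'.repr.toLinearEquiv.toLinearMap ∘ₗ
    (UniformSpace.Completion.toComplL (𝕜 := ℂ) (E := W)).toLinearMap, fun ξ η => ?_⟩
  change inner ℂ (b'.repr (ξ : UniformSpace.Completion W)) (b'.repr (η : UniformSpace.Completion W))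
    = _
  rw [LinearIsometryEquiv.inner_map_map, UniformSpace.Completion.inner_coe]
  rfl

/-! ### Smoothness of pullbacks of smooth maps on normed spaces -/

lemma ContDiff.lcSmoothOn_comp {X Y F : Type*} [AddCommGroup X] [Module ℝ X] [TopologicalSpace X]
    [NormedAddCommGroup Y] [NormedSpace ℝ Y] [NormedAddCommGroup F] [NormedSpace ℝ F]
    {f : Y → F} (hf : ContDiff ℝ ⊤ f) (L : X →L[ℝ] Y) (U : Set X) :
    LCSmoothOn (fun x => f (L x)) U := by
  -- `iteratedFDeriv` takes the newest direction first, while `LCSmoothOn` appends it last.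
  -- Reversing the indices reconciles the two without symmetry of higher derivatives.
  refine ⟨fun m x h => iteratedFDeriv ℝ m f (L x) fun i => L (h i.rev), ?_, ?_, ?_⟩
  · intro x _ h
    simp
  · intro m x _ h e
    have hd : Differentiable ℝ (iteratedFDeriv ℝ m f) :=
      hf.differentiable_iteratedFDeriv (by exact_mod_cast WithTop.coe_lt_top _)
    have h1 := ((hd (L x)).hasFDerivAt.hasLineDerivAt (L e)).tendsto_slope_zero
    have h2 := ((ContinuousMultilinearMap.apply ℝ (fun _ : Fin m => Y) F
      fun i => L (h i.rev)).continuous.tendsto _).comp h1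
    have hs : (fun i : Fin (m + 1) => L (Fin.snoc (α := fun _ => X) h e i.rev)) =
        Fin.cons (L e) fun i => L (h i.rev) := by
      ext i
      refine Fin.cases ?_ (fun i => ?_) i
      · simp
      · simp [Fin.rev_succ]
    show Filter.Tendsto _ _ (𝓝 (iteratedFDeriv ℝ (m + 1) f (L x) fun i =>
      L (Fin.snoc (α := fun _ => X) h e i.rev)))
    rw [iteratedFDeriv_succ_apply_left, hs]
    rw [show L (Fin.snoc (α := fun _ => X) h e (Fin.rev 0)) = L e by simp, Fin.tail_cons]
    refine h2.congr fun t => ?_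
    simp
  · intro m
    have : Continuous (iteratedFDeriv ℝ m f) := hf.continuous_iteratedFDeriv le_top
    refine Continuous.continuousOn ?_
    have h1 : Continuous fun p : X × (Fin m → X) => iteratedFDeriv ℝ m f (L p.1) := by fun_prop
    have h2 : Continuous fun p : X × (Fin m → X) => fun i : Fin m => L (p.2 i.rev) := by fun_prop
    exact h1.eval h2

/-! ### The Fock representation -/

/-- The prefactor is chosen so that the terms ⟨x, u⟩, ⟨u, y⟩ and ⟨u, u⟩ of ⟨x + u, y + u⟩ cancel in
the Gram kernel. -/
lemma exists_weyl {E ℋ : Type*} [NormedAddCommGroup E] [InnerProductSpace ℂ E]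
    [NormedAddCommGroup ℋ] [InnerProductSpace ℂ ℋ] [CompleteSpace ℋ] {κ : E → ℋ}
    (hκ : ∀ x y, inner ℂ (κ x) (κ y) = Complex.exp (inner ℂ x y))
    (hd : Dense (Submodule.span ℂ (Set.range κ) : Set ℋ)) (z : Circle) (u : E) :
    ∃ U : ℋ ≃ₗᵢ[ℂ] ℋ, ∀ x,
      U (κ x) = ((z : ℂ) * Complex.exp (-inner ℂ u u / 2 - inner ℂ u x)) • κ (x + u) := by
  refine exists_isometryEquiv_of_gram_eq _ _ hd ?_ fun x y => ?_
  · refine hd.mono (Submodule.span_le.2 ?_)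
    rintro _ ⟨x, rfl⟩
    have h0 : (z : ℂ) * Complex.exp (-inner ℂ u u / 2 - inner ℂ u (x - u)) ≠ 0 :=
      mul_ne_zero (Circle.coe_ne_zero z) (Complex.exp_ne_zero _)
    rw [SetLike.mem_coe, ← Submodule.smul_mem_iff _ h0]
    refine Submodule.subset_span ⟨x - u, ?_⟩
    simp
  · have hz : conj (z : ℂ) * z = 1 := by
      rw [← Complex.normSq_eq_conj_mul_self, Circle.normSq_coe, Complex.ofReal_one]
    rw [inner_smul_left, inner_smul_right, hκ, hκ, map_mul, ← Complex.exp_conj]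
    calc _ = (conj (z : ℂ) * z) * (Complex.exp (inner ℂ x y)) := by rw [hz, one_mul]
      _ = (conj (z : ℂ) * z) * (Complex.exp (conj (-inner ℂ u u / 2 - inner ℂ u x)) *
          (Complex.exp (-inner ℂ u u / 2 - inner ℂ u y) * Complex.exp (inner ℂ (x + u) (y + u)))) := by
        rw [← Complex.exp_add, ← Complex.exp_add]
        congr 2
        simp only [map_sub, map_div₀, map_neg, inner_conj_symm, inner_add_left, inner_add_right]
        simp only [Complex.conj_ofNat]
        ring
      _ = _ := by ring

lemma exists_fockRep {V : Type u} [AddCommGroup V] [Module ℝ V] [TopologicalSpace V]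
    {ω : LinearMap.BilinForm ℝ V} {E ℋ : Type*} [NormedAddCommGroup E] [InnerProductSpace ℂ E]
    [NormedAddCommGroup ℋ] [InnerProductSpace ℂ ℋ] [CompleteSpace ℋ] {κ : E → ℋ}
    (hκs : ContDiff ℂ ⊤ κ) (hκ : ∀ x y, inner ℂ (κ x) (κ y) = Complex.exp (inner ℂ x y))
    (hd : Dense (Submodule.span ℂ (Set.range κ) : Set ℋ)) (j : V →L[ℝ] E)
    (hj : ∀ v w, ω v w = -2 * (inner ℂ (j v) (j w)).im) :
    ∃ ρ : HeisenbergGroup ω →* (ℋ ≃ₗᵢ[ℂ] ℋ), IsSmoothUnitaryRep ρ ∧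
      ∀ (z : Circle) (ψ : ℋ), ρ ⟨z, 0⟩ ψ = (z : ℂ) • ψ := by
  choose ρ hρ using fun g : HeisenbergGroup ω => exists_weyl hκ hd g.phase (j g.vec)
  refine ⟨MonoidHom.mk' ρ fun g h => isometryEquiv_ext_of_dense_span κ hd fun x => ?_, ?_, ?_⟩
  · rw [LinearIsometryEquiv.coe_mul, Function.comp_apply, hρ, hρ, map_smul, hρ, smul_smul]
    simp only [HeisenbergGroup.mul_phase, HeisenbergGroup.mul_vec, map_add, Circle.coe_mul,
      Circle.coe_exp, hj]
    have hc : x + (j g.vec + j h.vec) = x + j h.vec + j g.vec := by abel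
    rw [hc]
    congr 1
    -- The group cocycle i ω / 2 equals -i Im⟨j g, j h⟩, the antisymmetric part left over when two
    -- prefactors are composed.
    have hre : ((-2 * (inner ℂ (j g.vec) (j h.vec)).im / 2 : ℝ) : ℂ) * Complex.I =
        (inner ℂ (j h.vec) (j g.vec) - inner ℂ (j g.vec) (j h.vec)) / 2 := by
      rw [← inner_conj_symm (j h.vec) (j g.vec)]
      generalize (inner ℂ (j g.vec) (j h.vec) : ℂ) = a
      apply Complex.ext
      · simp
      · simp
        ring
    have hexp : Complex.exp ((inner ℂ (j h.vec) (j g.vec) - inner ℂ (j g.vec) (j h.vec)) / 2) *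
        Complex.exp (-inner ℂ (j g.vec + j h.vec) (j g.vec + j h.vec) / 2 -
          inner ℂ (j g.vec + j h.vec) x) =
        Complex.exp (-inner ℂ (j h.vec) (j h.vec) / 2 - inner ℂ (j h.vec) x) *
        Complex.exp (-inner ℂ (j g.vec) (j g.vec) / 2 - inner ℂ (j g.vec) (x + j h.vec)) := by
      rw [← Complex.exp_add, ← Complex.exp_add]
      congr 1
      simp only [inner_add_left, inner_add_right]
      ring
    rw [hre]
    linear_combination (g.phase : ℂ) * (h.phase : ℂ) * hexp
  -- The orbit map factors through a smooth map on the normed space ℝ × E; the topology of V enters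
  -- only through the continuous linear map `j`.
  · have key : ∀ ψ ∈ Submodule.span ℂ (Set.range κ), ∃ F : ℝ × E → ℋ, ContDiff ℝ ⊤ F ∧
        ∀ (t : ℝ) (v : V), ρ ⟨Circle.exp t, v⟩ ψ = F (t, j v) := by
      intro ψ hψ
      induction hψ using Submodule.span_induction with
      | mem ψ hψ =>
        obtain ⟨x, rfl⟩ := hψ
        refine ⟨fun p => (Complex.exp (p.1 * Complex.I) *
          Complex.exp (-inner ℂ p.2 p.2 / 2 - inner ℂ p.2 x)) • κ (x + p.2), ?_, fun t v => ?_⟩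
        · have h1 : ContDiff ℝ ⊤ fun p : ℝ × E => κ (x + p.2) :=
            (hκs.restrict_scalars ℝ).comp (contDiff_const.add contDiff_snd)
          have h2 : ContDiff ℝ ⊤ fun p : ℝ × E => (inner ℂ p.2 p.2 : ℂ) :=
            contDiff_snd.inner ℂ contDiff_snd
          have h3 : ContDiff ℝ ⊤ fun p : ℝ × E => (inner ℂ p.2 x : ℂ) :=
            contDiff_snd.inner ℂ contDiff_const
          have h4 : ContDiff ℝ ⊤ fun p : ℝ × E => (p.1 : ℂ) * Complex.I :=
            (Complex.ofRealCLM.contDiff.comp contDiff_fst).mul contDiff_const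
          exact (h4.cexp.mul ((h2.neg.div_const 2).sub h3).cexp).smul h1
        · rw [hρ]
          simp
      | zero => exact ⟨0, contDiff_const, by simp⟩
      | add ψ φ _ _ h1 h2 =>
        obtain ⟨F, hF, hF'⟩ := h1
        obtain ⟨G, hG, hG'⟩ := h2
        exact ⟨F + G, hF.add hG, by simp [hF', hG']⟩
      | smul c ψ _ h1 =>
        obtain ⟨F, hF, hF'⟩ := h1
        exact ⟨c • F, contDiff_const.smul hF, by simp [hF']⟩
    refine hd.mono fun ψ hψ θ => ?_
    obtain ⟨F, hF, hF'⟩ := key ψ hψ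
    have := hF.lcSmoothOn_comp ((ContinuousLinearMap.id ℝ ℝ).prodMap j)
      (Set.Ioo (θ - Real.pi) (θ + Real.pi) ×ˢ Set.univ)
    convert! this using 2 with p
    exact hF' p.1 p.2
  · intro z ψ
    have h : Set.EqOn (ρ ⟨z, 0⟩) (fun ψ => (z : ℂ) • ψ)
        (Submodule.span ℂ (Set.range κ) : Set ℋ) := by
      have hr : Set.EqOn (ρ ⟨z, 0⟩ : ℋ →ₗ[ℂ] ℋ) ((z : ℂ) • LinearMap.id : ℋ →ₗ[ℂ] ℋ)
          (Set.range κ) := by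
        rintro _ ⟨x, rfl⟩
        simpa using hρ ⟨z, 0⟩ x
      exact LinearMap.eqOn_span hr
    exact congrFun (Continuous.ext_on hd (ρ ⟨z, 0⟩).continuous (continuous_const_smul _) h) ψ

/-! ### The derived representation on a smooth vector -/

section Derived

variable {V : Type*} [AddCommGroup V] [Module ℝ V] {ω : LinearMap.BilinForm ℝ V}
  {ℋ : Type*} [NormedAddCommGroup ℋ] [InnerProductSpace ℂ ℋ]

lemma weyl_apply_weyl {ρ : HeisenbergGroup ω →* (ℋ ≃ₗᵢ[ℂ] ℋ)}
    (hρ : ∀ (z : Circle) (ψ : ℋ), ρ ⟨z, 0⟩ ψ = (z : ℂ) • ψ) (v w : V) (ψ : ℋ) :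
    ρ ⟨1, v⟩ (ρ ⟨1, w⟩ ψ) = Complex.exp ((ω v w / 2 : ℝ) * Complex.I) • ρ ⟨1, v + w⟩ ψ := by
  have h : (⟨1, v⟩ * ⟨1, w⟩ : HeisenbergGroup ω) =
      ⟨Circle.exp (ω v w / 2), 0⟩ * ⟨1, v + w⟩ := by
    ext1 <;> simp
  rw [← Circle.coe_exp, ← hρ, ← Function.comp_apply (f := ρ ⟨1, v⟩), ← LinearIsometryEquiv.coe_mul,
    ← map_mul, h, map_mul, LinearIsometryEquiv.coe_mul, Function.comp_apply]

lemma inner_weyl_left {ρ : HeisenbergGroup ω →* (ℋ ≃ₗᵢ[ℂ] ℋ)} (hω : ∀ v v' : V, ω v' v = -ω v v')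
    (hρ : ∀ (z : Circle) (ψ : ℋ), ρ ⟨z, 0⟩ ψ = (z : ℂ) • ψ) (v : V) (φ ψ : ℋ) :
    inner ℂ (ρ ⟨1, -v⟩ φ) ψ = inner ℂ φ (ρ ⟨1, v⟩ ψ) := by
  have hv : ω v v = 0 := by linarith [hω v v]
  rw [← LinearIsometryEquiv.inner_map_map (ρ ⟨1, v⟩), weyl_apply_weyl hρ]
  simp [hv, hρ]

lemma hasDerivAt_weyl_smul {ρ : HeisenbergGroup ω →* (ℋ ≃ₗᵢ[ℂ] ℋ)} {ψ a : ℋ} {v : V}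
    (h : HasDerivAt (fun t : ℝ => ρ ⟨1, t • v⟩ ψ) a 0) (c : ℝ) :
    HasDerivAt (fun t : ℝ => ρ ⟨1, t • c • v⟩ ψ) (c • a) 0 := by
  have hc : HasDerivAt (fun t : ℝ => t * c) c 0 := by simpa using (hasDerivAt_id (0 : ℝ)).mul_const c
  have := HasDerivAt.scomp (g₁ := fun t : ℝ => ρ ⟨1, t • v⟩ ψ) (x := (0 : ℝ)) (g₁' := a)
    (h := fun t : ℝ => t * c) (by simpa using h) hc
  refine this.congr_of_eventuallyEq (Filter.Eventually.of_forall fun t => ?_)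
  simp [smul_smul]

lemma hasDerivAt_weyl_neg {ρ : HeisenbergGroup ω →* (ℋ ≃ₗᵢ[ℂ] ℋ)} {ψ a : ℋ} {v : V}
    (h : HasDerivAt (fun t : ℝ => ρ ⟨1, t • v⟩ ψ) a 0) :
    HasDerivAt (fun t : ℝ => ρ ⟨1, -(t • v)⟩ ψ) (-a) 0 := by
  simpa using hasDerivAt_weyl_smul h (-1)

lemma weyl_zero (ρ : HeisenbergGroup ω →* (ℋ ≃ₗᵢ[ℂ] ℋ)) (ψ : ℋ) : ρ ⟨1, 0⟩ ψ = ψ := by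
  have : (⟨1, 0⟩ : HeisenbergGroup ω) = 1 := rfl
  rw [this, map_one]
  rfl

/-- Differentiate ⟨W(-t v) φ, W(t w) ψ⟩ = exp(i t² ω(v, w) / 2) ⟨φ, W(t(v + w)) ψ⟩ at 0, where the
phase has derivative 0. Moving W(t v) onto φ avoids differentiating it on a moving vector; constancy
of ⟨W(t v) φ, W(t v) ψ⟩ turns the derivative on φ back into one on ψ. -/
lemma derived_add {ρ : HeisenbergGroup ω →* (ℋ ≃ₗᵢ[ℂ] ℋ)} (hω : ∀ v v' : V, ω v' v = -ω v v')
    (hρ : ∀ (z : Circle) (ψ : ℋ), ρ ⟨z, 0⟩ ψ = (z : ℂ) • ψ) {ψ a b c φ d : ℋ} {v w : V}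
    (ha : HasDerivAt (fun t : ℝ => ρ ⟨1, t • v⟩ ψ) a 0)
    (hb : HasDerivAt (fun t : ℝ => ρ ⟨1, t • w⟩ ψ) b 0)
    (hc : HasDerivAt (fun t : ℝ => ρ ⟨1, t • (v + w)⟩ ψ) c 0)
    (hd : HasDerivAt (fun t : ℝ => ρ ⟨1, t • v⟩ φ) d 0) :
    inner ℂ φ c = inner ℂ φ (a + b) := by
  have h1 := hd.inner ℂ ha
  have h2 := (hasDerivAt_weyl_neg hd).inner ℂ hb
  have h3 := (hasDerivAt_const (0 : ℝ) φ).inner ℂ hc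
  simp only [LinearIsometryEquiv.inner_map_map, zero_smul, weyl_zero, neg_zero, inner_zero_left,
    inner_neg_left, add_zero] at h1 h2 h3
  have h4 := h1.unique (hasDerivAt_const _ _)
  have h5 : HasDerivAt (fun t : ℝ => Complex.exp ((t ^ 2 * (ω v w / 2) : ℝ) * Complex.I)) 0 0 := by
    have : HasDerivAt (fun t : ℝ => t ^ 2 * (ω v w / 2)) 0 0 := by
      simpa using ((hasDerivAt_id (0 : ℝ)).pow 2).mul_const (ω v w / 2)
    simpa using (this.ofReal_comp.mul_const Complex.I).cexp
  have h6 := h5.mul h3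
  simp only [zero_smul, weyl_zero, zero_mul, zero_add] at h6
  have h7 := h6.congr_of_eventuallyEq (f₁ := fun t : ℝ =>
    inner ℂ (ρ ⟨1, -(t • v)⟩ φ) (ρ ⟨1, t • w⟩ ψ)) (Filter.Eventually.of_forall fun t => by
      simp only [Pi.mul_apply]
      rw [inner_weyl_left hω hρ, weyl_apply_weyl hρ, inner_smul_right, smul_add]
      congr 4
      simp
      ring)
  have h8 := h2.unique h7
  rw [inner_add_right]
  simp only [zero_pow two_ne_zero, Complex.ofReal_zero, zero_mul, Complex.exp_zero, one_mul] at h8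
  linear_combination -h4 - h8

/-- Take the mixed derivative of W(s v) W(t w) = exp(i s t ω(v, w)) W(t w) W(s v) between ψ and ψ.
With one operator moved to each side of the inner product, only first derivatives of orbit maps
occur. -/
lemma derived_comm {ρ : HeisenbergGroup ω →* (ℋ ≃ₗᵢ[ℂ] ℋ)} (hω : ∀ v v' : V, ω v' v = -ω v v')
    (hρ : ∀ (z : Circle) (ψ : ℋ), ρ ⟨z, 0⟩ ψ = (z : ℂ) • ψ) {ψ a b : ℋ} {v w : V}
    (ha : HasDerivAt (fun t : ℝ => ρ ⟨1, t • v⟩ ψ) a 0)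
    (hb : HasDerivAt (fun t : ℝ => ρ ⟨1, t • w⟩ ψ) b 0) :
    inner ℂ a b - inner ℂ b a = -(ω v w * Complex.I) * inner ℂ ψ ψ := by
  have key : ∀ s t : ℝ, inner ℂ (ρ ⟨1, -(s • v)⟩ ψ) (ρ ⟨1, t • w⟩ ψ) =
      Complex.exp (s * (t * ω v w * Complex.I)) *
        inner ℂ (ρ ⟨1, -(t • w)⟩ ψ) (ρ ⟨1, s • v⟩ ψ) := fun s t => by
    rw [inner_weyl_left hω hρ, inner_weyl_left hω hρ, weyl_apply_weyl hρ, weyl_apply_weyl hρ,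
      inner_smul_right, inner_smul_right, ← mul_assoc, ← Complex.exp_add, add_comm (t • w)]
    congr 2
    simp only [map_smul, LinearMap.smul_apply, smul_eq_mul, hω v w]
    push_cast
    ring
  -- The derivative in s at 0 with t kept free; the derivative in t follows.
  have h1 : ∀ t : ℝ, -inner ℂ a (ρ ⟨1, t • w⟩ ψ) =
      (t * ω v w * Complex.I) * inner ℂ (ρ ⟨1, -(t • w)⟩ ψ) ψ +
        inner ℂ (ρ ⟨1, -(t • w)⟩ ψ) a := fun t => by
    have hl := (hasDerivAt_weyl_neg ha).inner ℂ (hasDerivAt_const (0 : ℝ) (ρ ⟨1, t • w⟩ ψ))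
    have he : HasDerivAt (fun s : ℝ => Complex.exp (s * (t * ω v w * Complex.I)))
        (t * ω v w * Complex.I) 0 := by
      simpa using ((hasDerivAt_id (0 : ℝ)).ofReal_comp.mul_const (t * ω v w * Complex.I : ℂ)).cexp
    have hr := he.mul ((hasDerivAt_const (0 : ℝ) (ρ ⟨1, -(t • w)⟩ ψ)).inner ℂ ha)
    have := hl.unique (hr.congr_of_eventuallyEq (Filter.Eventually.of_forall fun s => key s t))
    simpa [weyl_zero] using this
  have hl := ((hasDerivAt_const (0 : ℝ) a).inner ℂ hb).neg
  have he : HasDerivAt (fun t : ℝ => (t * ω v w * Complex.I : ℂ)) (ω v w * Complex.I) 0 := by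
    simpa [mul_assoc] using
      (hasDerivAt_id (0 : ℝ)).ofReal_comp.mul_const (ω v w * Complex.I : ℂ)
  have hr := (he.mul ((hasDerivAt_weyl_neg hb).inner ℂ (hasDerivAt_const (0 : ℝ) ψ))).add
    ((hasDerivAt_weyl_neg hb).inner ℂ (hasDerivAt_const (0 : ℝ) a))
  have := hl.unique (hr.congr_of_eventuallyEq (Filter.Eventually.of_forall h1))
  simp only [zero_smul, weyl_zero, neg_zero, inner_zero_left, inner_zero_right, inner_neg_left,
    add_zero, zero_add, Complex.ofReal_zero, zero_mul] at this
  linear_combination -this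

variable [TopologicalSpace V]

/-- Continuity in v is the joint continuity of the first directional derivative, read in the chart θ
= 0 at the identity. -/
lemma IsSmoothVector.exists_hasDerivAt {ρ : HeisenbergGroup ω →* (ℋ ≃ₗᵢ[ℂ] ℋ)} {ψ : ℋ}
    (hψ : IsSmoothVector ρ ψ) : ∃ A : V → ℋ, Continuous A ∧
      ∀ v, HasDerivAt (fun t : ℝ => ρ ⟨1, t • v⟩ ψ) (A v) 0 := by
  obtain ⟨D, h0, h1, hc⟩ := hψ 0
  have hmem : ∀ v : V, ((0, v) : ℝ × V) ∈
      Set.Ioo (0 - Real.pi) (0 + Real.pi) ×ˢ (Set.univ : Set V) := fun v => by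
    simp [Real.pi_pos]
  refine ⟨fun v => D 1 (0, 0) fun _ => (0, v), ?_, fun v => ?_⟩
  · have hf : Continuous fun v : V => (((0, 0), fun _ => (0, v)) : (ℝ × V) × (Fin 1 → ℝ × V)) := by
      fun_prop
    exact (hc 1).comp_continuous hf fun v => ⟨hmem 0, trivial⟩
  · rw [hasDerivAt_iff_tendsto_slope_zero]
    have h := h1 0 (0, 0) (hmem 0) Fin.elim0 (0, v)
    have hs : (Fin.snoc (α := fun _ => ℝ × V) Fin.elim0 (0, v) : Fin 1 → ℝ × V) =
        fun _ => (0, v) := by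
      funext i
      rw [Fin.fin_one_eq_zero i]
      rfl
    rw [hs] at h
    refine Filter.Tendsto.congr (fun t => ?_) h
    have ht : ((0, 0) : ℝ × V) + t • (0, v) = (0, t • v) := by simp
    beta_reduce
    rw [ht, h0 _ (hmem _), h0 _ (hmem _)]
    simp

/-- The derived representation `v ↦ dρ(v) ψ` on a smooth vector `ψ`. -/
lemma IsSmoothVector.exists_derived {ρ : HeisenbergGroup ω →* (ℋ ≃ₗᵢ[ℂ] ℋ)} {ψ : ℋ}
    (hω : ∀ v v' : V, ω v' v = -ω v v') (hρs : IsSmoothUnitaryRep ρ)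
    (hρ : ∀ (z : Circle) (ψ : ℋ), ρ ⟨z, 0⟩ ψ = (z : ℂ) • ψ) (hψ : IsSmoothVector ρ ψ) :
    ∃ A : V →ₗ[ℝ] ℋ, Continuous A ∧ ∀ v w,
      inner ℂ (A v) (A w) - inner ℂ (A w) (A v) = -(ω v w * Complex.I) * inner ℂ ψ ψ := by
  obtain ⟨A, hAc, hA⟩ := hψ.exists_hasDerivAt
  refine ⟨{ toFun := A, map_add' := fun v w => ?_, map_smul' := fun c v => ?_ }, hAc,
    fun v w => derived_comm hω hρ (hA v) (hA w)⟩
  -- `derived_add` tests only against smooth φ; their density gives every φ.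
  · refine ext_inner_left ℂ fun φ => ?_
    refine congrFun (Continuous.ext_on (f := fun φ => inner ℂ φ (A (v + w)))
      (g := fun φ => inner ℂ φ (A v + A w)) hρs (by fun_prop) (by fun_prop) fun φ hφ => ?_) φ
    obtain ⟨B, -, hB⟩ := IsSmoothVector.exists_hasDerivAt hφ
    exact derived_add hω hρ (hA v) (hA w) (hA (v + w)) (hB v)
  · exact (hA (c • v)).unique (hasDerivAt_weyl_smul (hA v) c)

end Derived

/-! ### Hermitian forms on the complexification -/

namespace Complexified

variable {V : Type*} [AddCommGroup V]
lemma ofReal_fst (v : V) : (ofReal v).1 = v := rfl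
lemma ofReal_snd (v : V) : (ofReal v).2 = 0 := rfl
lemma add_fst (ξ η : Complexified V) : (ξ + η).1 = ξ.1 + η.1 := rfl
lemma add_snd (ξ η : Complexified V) : (ξ + η).2 = ξ.2 + η.2 := rfl

variable [Module ℝ V]

lemma smul_fst (c : ℂ) (ξ : Complexified V) : (c • ξ).1 = c.re • ξ.1 - c.im • ξ.2 := rfl
lemma smul_snd (c : ℂ) (ξ : Complexified V) : (c • ξ).2 = c.re • ξ.2 + c.im • ξ.1 := rfl

variable {F : Type*} [AddCommGroup F] [Module ℂ F]

/-- The complex linear extension `x + i y ↦ A x + i A y`. -/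
def linearExt (A : V →ₗ[ℝ] F) : Complexified V →ₗ[ℂ] F where
  toFun ξ := A ξ.1 + Complex.I • A ξ.2
  map_add' ξ η := by
    simp only [add_fst, add_snd, map_add, smul_add]
    abel
  map_smul' c ξ := by
    rw [smul_fst, smul_snd, map_add, map_sub, map_smul, map_smul, map_smul, map_smul,
      RingHom.id_apply]
    simp only [← Complex.coe_smul]
    match_scalars
    · linear_combination Complex.re_add_im c
    · linear_combination Complex.I * Complex.re_add_im c - (c.im : ℂ) * Complex.I_sq

/-- The antilinear extension `x + i y ↦ A x - i A y`. -/
def antilinearExt (A : V →ₗ[ℝ] F) : Complexified V →ₗ⋆[ℂ] F where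
  toFun ξ := A ξ.1 - Complex.I • A ξ.2
  map_add' ξ η := by
    simp only [add_fst, add_snd, map_add, smul_add]
    abel
  map_smul' c ξ := by
    rw [smul_fst, smul_snd, map_add, map_sub, map_smul, map_smul, map_smul, map_smul]
    have hc : (c.re : ℂ) - c.im * Complex.I = conj c := by
      rw [← Complex.re_add_im (conj c)]
      simp [sub_eq_add_neg]
    simp only [← Complex.coe_smul]
    match_scalars
    · linear_combination hc
    · linear_combination -Complex.I * hc - (c.im : ℂ) * Complex.I_sq

end Complexified

lemma exists_hermitianInnerProduct {V : Type*} [AddCommGroup V] [Module ℝ V] [TopologicalSpace V]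
    {ℋ : Type*} [NormedAddCommGroup ℋ] [InnerProductSpace ℂ ℋ] (A : V →ₗ[ℝ] ℋ) (hA : Continuous A)
    (hA0 : ∀ v, A v = 0 → v = 0) :
    ∃ H : Complexified V →ₗ⋆[ℂ] Complexified V →ₗ[ℂ] ℂ, IsHermitianInnerProduct H ∧
      ∀ v w, (H (Complexified.ofReal v) (Complexified.ofReal w)).im = (inner ℂ (A v) (A w) : ℂ).im := by
  set h := Complexified.linearExt A
  set k := Complexified.antilinearExt A
  have hdef : ∀ ξ, h ξ = A ξ.1 + Complex.I • A ξ.2 := fun ξ => rfl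
  have kdef : ∀ ξ, k ξ = A ξ.1 - Complex.I • A ξ.2 := fun ξ => rfl
  have hcont : Continuous h := by
    have h1 : Continuous fun ξ : V × V => A ξ.1 + Complex.I • A ξ.2 := by fun_prop
    exact h1
  have kcont : Continuous k := by
    have h1 : Continuous fun ξ : V × V => A ξ.1 - Complex.I • A ξ.2 := by fun_prop
    exact h1
  -- Both summands are Hermitian and semidefinite. On V they give p a + q conj a with a = ⟨A v, A
  -- w⟩, whose imaginary part is that of a when p - q = 1; positivity of both weights makes the
  -- kernel ker h ∩ ker k. Here p = 3/2 and q = 1/2.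
  refine ⟨LinearMap.mk₂'ₛₗ (starRingEnd ℂ) (RingHom.id ℂ)
    (fun ξ η => (3 / 2) * inner ℂ (h ξ) (h η) + (1 / 2) * inner ℂ (k η) (k ξ))
    (fun ξ ξ' η => ?_) (fun c ξ η => ?_) (fun ξ η η' => ?_) (fun c ξ η => ?_), ⟨?_, ?_, ?_⟩, ?_⟩
  · simp only [map_add, inner_add_left, inner_add_right]; ring
  · simp only [map_smul, map_smulₛₗ, inner_smul_left, inner_smul_right, smul_eq_mul]; ring
  · simp only [map_add, inner_add_left, inner_add_right]; ring
  · simp only [map_smul, map_smulₛₗ, inner_smul_left, inner_smul_right, smul_eq_mul,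
      RingHom.id_apply, Complex.conj_conj]; ring
  · intro ξ η
    simp only [LinearMap.mk₂'ₛₗ_apply, map_add, map_mul, inner_conj_symm, map_div₀, map_one,
      Complex.conj_ofNat]
  · intro ξ hξ
    rw [LinearMap.mk₂'ₛₗ_apply, inner_self_eq_norm_sq_to_K, inner_self_eq_norm_sq_to_K]
    have hre : ((3 / 2 : ℂ) * (‖h ξ‖ : ℂ) ^ 2 + (1 / 2) * (‖k ξ‖ : ℂ) ^ 2).re =
        3 / 2 * ‖h ξ‖ ^ 2 + 1 / 2 * ‖k ξ‖ ^ 2 := by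
      rw [← Complex.ofReal_re (3 / 2 * ‖h ξ‖ ^ 2 + 1 / 2 * ‖k ξ‖ ^ 2)]
      push_cast
      rfl
    refine lt_of_lt_of_eq ?_ hre.symm
    by_contra hle
    have h1 : ‖h ξ‖ ^ 2 = 0 := by nlinarith [sq_nonneg ‖h ξ‖, sq_nonneg ‖k ξ‖]
    have h2 : ‖k ξ‖ ^ 2 = 0 := by nlinarith [sq_nonneg ‖h ξ‖, sq_nonneg ‖k ξ‖]
    have h3 : h ξ = 0 := by simpa using h1
    have h4 : k ξ = 0 := by simpa using h2
    rw [hdef] at h3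
    rw [kdef, sub_eq_zero] at h4
    -- From A x = -i A y and A x = i A y it follows that 2 i A y = 0.
    have h5 : A ξ.2 = 0 := by
      rw [h4, ← two_smul ℂ, smul_smul] at h3
      exact (smul_eq_zero.1 h3).resolve_left (by simp)
    have h6 : A ξ.1 = 0 := by rw [h4, h5, smul_zero]
    exact hξ (Prod.ext (hA0 _ h6) (hA0 _ h5))
  · simp only [LinearMap.mk₂'ₛₗ_apply]
    fun_prop
  · intro v w
    have h1 : ∀ v, h (Complexified.ofReal v) = A v := fun v => by
      simp [hdef, Complexified.ofReal_fst, Complexified.ofReal_snd]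
    have h2 : ∀ v, k (Complexified.ofReal v) = A v := fun v => by
      simp [kdef, Complexified.ofReal_fst, Complexified.ofReal_snd]
    rw [LinearMap.mk₂'ₛₗ_apply, h1, h1, h2, h2, ← inner_conj_symm (A w)]
    generalize (inner ℂ (A v) (A w) : ℂ) = a
    have : (3 / 2 * a + 1 / 2 * conj a) = a + ((a.re : ℝ) : ℂ) := by
      rw [Complex.re_eq_add_conj]; ring
    rw [this]
    simp


/-- The restriction to `V` of an isometric embedding of `V_ℂ` into a Hilbert space. -/
lemma IsHermitianInnerProduct.exists_continuousLinearMap {V : Type*} [AddCommGroup V] [Module ℝ V]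
    [TopologicalSpace V] [IsTopologicalAddGroup V]
    {H : Complexified V →ₗ⋆[ℂ] Complexified V →ₗ[ℂ] ℂ} (hH : IsHermitianInnerProduct H)
    {E : Type*} [NormedAddCommGroup E] [InnerProductSpace ℂ E] (j : Complexified V →ₗ[ℂ] E)
    (hj : ∀ ξ η, inner ℂ (j ξ) (j η) = H ξ η) :
    ∃ L : V →L[ℝ] E, ∀ v w,
      inner ℂ (L v) (L w) = H (Complexified.ofReal v) (Complexified.ofReal w) := by
  let L : V →ₗ[ℝ] E :=
    { toFun := fun v => j (Complexified.ofReal v)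
      map_add' := fun v w => by
        rw [← map_add]
        congr 1
        exact Prod.ext rfl (add_zero 0).symm
      map_smul' := fun c v => by
        rw [RingHom.id_apply, ← Complex.coe_smul, ← map_smul]
        congr 1
        refine Prod.ext ?_ ?_
        · rw [Complexified.smul_fst, Complexified.ofReal_fst, Complexified.ofReal_snd]
          simp [Complexified.ofReal_fst]
        · rw [Complexified.smul_snd, Complexified.ofReal_fst, Complexified.ofReal_snd]
          simp [Complexified.ofReal_snd] }
  have hL : ∀ v w, inner ℂ (L v) (L w) = H (Complexified.ofReal v) (Complexified.ofReal w) :=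
    fun v w => hj _ _
  have hcr : Continuous (Complexified.ofReal : V → Complexified V) :=
    (continuous_id.prodMk continuous_const : Continuous fun v : V => ((v, 0) : V × V))
  have hn : (fun v => ‖L v‖) = fun v =>
      √(H (Complexified.ofReal v) (Complexified.ofReal v)).re := by
    ext v
    rw [@norm_eq_sqrt_re_inner ℂ, hL]
    rfl
  have hc : Continuous fun v => ‖L v‖ := by
    rw [hn]
    exact (Complex.continuous_re.comp (hH.continuous.comp (hcr.prodMk hcr))).sqrt
  -- By linearity it is enough to look at 0, where ‖L v‖² = H(v, v) tends to 0.
  have hLc : Continuous L := by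
    refine continuous_of_continuousAt_zero L ?_
    rw [ContinuousAt, map_zero, tendsto_zero_iff_norm_tendsto_zero]
    simpa using hc.tendsto 0
  exact ⟨⟨L, hLc⟩, hL⟩

end

/-! ### The equivalence -/

theorem mainTheorem12 {V : Type u} [AddCommGroup V] [Module ℝ V] [TopologicalSpace V]
    [IsTopologicalAddGroup V] [ContinuousSMul ℝ V] [LocallyConvexSpace ℝ V] [T2Space V]
    (ω : LinearMap.BilinForm ℝ V)
    (hω_cont : Continuous fun p : V × V => ω p.1 p.2)
    (hω_skew : ∀ v v' : V, ω v' v = -ω v v')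
    (hω_nondeg : ∀ v : V, (∀ v' : V, ω v v' = 0) → v = 0) :
    (∃ (ℋ : Type (max u w)) (_ : NormedAddCommGroup ℋ) (_ : InnerProductSpace ℂ ℋ)
        (_ : CompleteSpace ℋ) (_ : Nontrivial ℋ)
        (ρ : HeisenbergGroup ω →* (ℋ ≃ₗᵢ[ℂ] ℋ)),
        IsSmoothUnitaryRep ρ ∧
        ∀ (z : Circle) (ψ : ℋ), ρ ⟨z, 0⟩ ψ = (z : ℂ) • ψ) ↔
      ∃ H : Complexified V →ₗ⋆[ℂ] Complexified V →ₗ[ℂ] ℂ,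
        IsHermitianInnerProduct H ∧
        ∀ v v' : V,
          ω v v' = -2 * (H (Complexified.ofReal v) (Complexified.ofReal v')).im := by
  constructor
  · rintro ⟨ℋ, _, _, _, _, ρ, hρs, hρ⟩
    obtain ⟨ψ, hψ, hψ0⟩ : ∃ ψ : ℋ, IsSmoothVector ρ ψ ∧ ψ ≠ 0 := by
      obtain ⟨ψ, hψ0, hψ⟩ := Dense.exists_mem_open hρs isOpen_compl_singleton
        (exists_ne (0 : ℋ))
      exact ⟨ψ, hψ0, hψ⟩
    obtain ⟨A, hAc, hA⟩ := hψ.exists_derived hω_skew hρs hρ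
    have hn : ‖ψ‖ ≠ 0 := norm_ne_zero_iff.2 hψ0
    have him : ∀ v w, ω v w * ‖ψ‖ ^ 2 = -2 * (inner ℂ (A v) (A w) : ℂ).im := fun v w => by
      have h := congrArg Complex.im (hA v w)
      rw [← inner_conj_symm (A w), inner_self_eq_norm_sq_to_K] at h
      generalize (inner ℂ (A v) (A w) : ℂ) = a at h ⊢
      have hr : (-(ω v w * Complex.I) * (‖ψ‖ : ℂ) ^ 2) =
          ((-(ω v w * ‖ψ‖ ^ 2) : ℝ) : ℂ) * Complex.I := by
        push_cast; ring
      have h' := h.trans (congrArg Complex.im hr)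
      rw [Complex.sub_im, Complex.conj_im, Complex.im_ofReal_mul, Complex.I_im] at h'
      linarith
    -- Dividing A by ‖ψ‖ removes the factor ‖ψ‖² from the commutation relation.
    have hB : ∀ v w, ω v w = -2 * (inner ℂ ((‖ψ‖⁻¹ • A) v) ((‖ψ‖⁻¹ • A) w) : ℂ).im := fun v w => by
      have : (inner ℂ ((‖ψ‖⁻¹ • A) v) ((‖ψ‖⁻¹ • A) w) : ℂ) =
          ((‖ψ‖⁻¹ * ‖ψ‖⁻¹ : ℝ) : ℂ) * inner ℂ (A v) (A w) := by
        simp only [LinearMap.smul_apply, ← Complex.coe_smul, inner_smul_left, inner_smul_right,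
          Complex.conj_ofReal]
        push_cast; ring
      rw [this, Complex.im_ofReal_mul]
      have := him v w
      field_simp
      linarith
    obtain ⟨H, hH, hHim⟩ := exists_hermitianInnerProduct (‖ψ‖⁻¹ • A)
      (hAc.const_smul _) fun v hv => hω_nondeg v fun w => by rw [hB, hv]; simp
    exact ⟨H, hH, fun v w => by rw [hHim, ← hB]⟩
  · rintro ⟨H, hH, hHω⟩
    obtain ⟨ι, j, hj⟩ := exists_isometric_embedding.{u, w} H hH.hermitian hH.posDef
    obtain ⟨ℋ, _, _, _, κ, hκs, hκ, hd⟩ := exists_total_coherent ι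
    obtain ⟨L, hL⟩ := hH.exists_continuousLinearMap j hj
    have hnt : Nontrivial ℋ := by
      refine nontrivial_of_ne (κ 0) 0 fun h => ?_
      have := hκ 0 0
      rw [h] at this
      simp at this
    obtain ⟨ρ, hρs, hρ⟩ := exists_fockRep hκs hκ hd L (ω := ω) fun v w => by
      rw [hHω]
      exact congrArg (fun c : ℂ => -2 * c.im) (hL v w).symm
    exact ⟨ℋ, inferInstance, inferInstance, inferInstance, hnt, ρ, hρs, hρ⟩
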